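/- For a bounded complex sequence $x=(x_n)_{n\in\mathbb N}$ put $\hat x:=(\sup_{k\ge n}|x_k|)_{n}$. For $1<q<\infty$ let $d(q):=\{x\in\ell_\infty:\hat x\in\ell_q\}$, with the norm $\|x\|_{d(q)}:=\|\hat x\|_q$. For $1\le p<\infty$ let $d(p+):=\bigcap_{q>p}d(q)$, with the locally convex topology generated by the norms $\|\cdot\|_{d(q)}$, $q>p$. Let $e_n:=(\delta_{kn})_k$ for $n\in\mathbb N$. **Lemma 4.1.** Let $1\le p<\infty$. Then $d(p+)$ is a Fréchet space, its topology is generated by the sequence of norms $\|\cdot\|_{d(p_k)}$, $k\in\mathbb N$, for every strictly decreasing sequence $(p_k)\subset(p,\infty)$ with $p_k\to p$, and: (i) The canonical vectors $\{e_n:n\in\mathbb N\}$ form an unconditional basis of $d(p+)$; that is, there are continuous linear functionals $f_n$ on $d(p+)$ with $f_i(e_j)=\delta_{ij}$ such that, for each $x\in d(p+)$, the series $\sum_n f_n(x)e_n$ converges unconditionally to $x$ in $d(p+)$. (ii) The Fréchet space $d(p+)$ is reflexive (the canonical evaluation map into its strong bidual is a surjective topological isomorphism) and separable. (iii) For every $q$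 with $p<q<\infty$, the inclusion $d(p+)\subseteq d(q+)$ holds and is proper. -/

import Mathlib

open Filter Topology
open scoped ENNReal

noncomputable section

/-! Complex sequences `x = (x_n)_n` are functions `x : ℕ → ℂ`; the index set `{1, 2, 3, …}` is
replaced by `{0, 1, 2, …}`, which changes nothing below since no weight depends on `n`. -/

/-- The least decreasing majorant `x̂ = (sup_{k ≥ n} |x_k|)_n` of `|x|` (for bounded `x`). -/
def leastDecrMajorant (x : ℕ → ℂ) (n : ℕ) : ℝ := ⨆ k : ℕ, ‖x (n + k)‖

theorem bddAbove_tail {x : ℕ → ℂ} (hx : Memℓp x ∞) (n : ℕ) :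
    BddAbove (Set.range fun k : ℕ => ‖x (n + k)‖) := by
  obtain ⟨C, hC⟩ := memℓp_infty_iff.1 hx
  refine ⟨C, ?_⟩
  rintro _ ⟨k, rfl⟩
  exact hC ⟨n + k, rfl⟩

theorem leastDecrMajorant_nonneg (x : ℕ → ℂ) (n : ℕ) : 0 ≤ leastDecrMajorant x n :=
  Real.iSup_nonneg fun _ => norm_nonneg _

theorem leastDecrMajorant_add_le {x y : ℕ → ℂ} (hx : Memℓp x ∞) (hy : Memℓp y ∞) (n : ℕ) :
    leastDecrMajorant (x + y) n ≤ leastDecrMajorant x n + leastDecrMajorant y n :=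
  ciSup_le fun k => (norm_add_le _ _).trans
    (add_le_add (le_ciSup (bddAbove_tail hx n) k) (le_ciSup (bddAbove_tail hy n) k))

theorem leastDecrMajorant_smul (c : ℂ) (x : ℕ → ℂ) :
    leastDecrMajorant (c • x) = ‖c‖ • leastDecrMajorant x := by
  funext n
  simp only [leastDecrMajorant, Pi.smul_apply, smul_eq_mul, norm_mul]
  exact (Real.mul_iSup_of_nonneg (norm_nonneg c) _).symm

/-- `d(q) = {x ∈ ℓ_∞ : x̂ ∈ ℓ_q}`, as a linear subspace of `ℂ^ℕ` (used for `1 < q < ∞`). -/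
def dSpace (q : ℝ) : Submodule ℂ (ℕ → ℂ) where
  carrier := {x | Memℓp x ∞ ∧ Memℓp (leastDecrMajorant x) (ENNReal.ofReal q)}
  zero_mem' := by
    refine ⟨zero_memℓp, ?_⟩
    have h : leastDecrMajorant (0 : ℕ → ℂ) = 0 := by
      funext n
      simp [leastDecrMajorant]
    rw [h]
    exact zero_memℓp
  add_mem' := by
    rintro x y ⟨hx, hx'⟩ ⟨hy, hy'⟩
    refine ⟨hx.add hy, Memℓp.mono (hx'.add hy') fun n => ?_⟩
    rw [Real.norm_of_nonneg (leastDecrMajorant_nonneg _ _)]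
    exact leastDecrMajorant_add_le hx hy n
  smul_mem' := by
    rintro c x ⟨hx, hx'⟩
    refine ⟨hx.const_smul c, ?_⟩
    rw [leastDecrMajorant_smul]
    exact hx'.const_smul ‖c‖

/-- `‖x‖_{d(q)} = ‖x̂‖_q = (∑_n x̂_n ^ q) ^ (1/q)`. -/
def dNorm (q : ℝ) (x : ℕ → ℂ) : ℝ := (∑' n, leastDecrMajorant x n ^ q) ^ (1 / q)

theorem summable_of_mem_dSpace {q : ℝ} (hq : 1 < q) {x : ℕ → ℂ} (hx : x ∈ dSpace q) :
    Summable fun n => leastDecrMajorant x n ^ q := by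
  have h0 : (0 : ℝ) ≤ q := by linarith
  have h := hx.2.summable (by rw [ENNReal.toReal_ofReal h0]; linarith)
  rw [ENNReal.toReal_ofReal h0] at h
  simpa only [Real.norm_of_nonneg (leastDecrMajorant_nonneg x _)] using h

theorem dNorm_add_le {q : ℝ} (hq : 1 < q) {x y : ℕ → ℂ} (hx : x ∈ dSpace q) (hy : y ∈ dSpace q) :
    dNorm q (x + y) ≤ dNorm q x + dNorm q y := by
  have h0 : (0 : ℝ) ≤ q := by linarith
  have h := Real.Lp_add_le_tsum_of_nonneg hq.le (leastDecrMajorant_nonneg x)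
    (leastDecrMajorant_nonneg y) (summable_of_mem_dSpace hq hx) (summable_of_mem_dSpace hq hy)
  refine le_trans (Real.rpow_le_rpow
    (tsum_nonneg fun n => Real.rpow_nonneg (leastDecrMajorant_nonneg _ n) q) ?_
    (by positivity)) h.2
  exact Summable.tsum_le_tsum
    (fun n => Real.rpow_le_rpow (leastDecrMajorant_nonneg _ n)
      (leastDecrMajorant_add_le hx.1 hy.1 n) h0)
    (summable_of_mem_dSpace hq ((dSpace q).add_mem hx hy)) h.1

theorem dNorm_smul {q : ℝ} (hq : 1 < q) (c : ℂ) (x : ℕ → ℂ) :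
    dNorm q (c • x) = ‖c‖ * dNorm q x := by
  have h0 : q ≠ 0 := by linarith
  simp only [dNorm, leastDecrMajorant_smul, Pi.smul_apply, smul_eq_mul]
  simp only [Real.mul_rpow (norm_nonneg c) (leastDecrMajorant_nonneg x _)]
  rw [tsum_mul_left, Real.mul_rpow (Real.rpow_nonneg (norm_nonneg c) q)
    (tsum_nonneg fun n => Real.rpow_nonneg (leastDecrMajorant_nonneg _ n) q), one_div,
    Real.rpow_rpow_inv (norm_nonneg c) h0]

/-- `d(p+) = ⋂_{q > p} d(q)`, as a linear subspace of `ℂ^ℕ`. -/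
def dPlus (p : ℝ) : Submodule ℂ (ℕ → ℂ) := ⨅ q : Set.Ioi p, dSpace q

theorem mem_dPlus {p : ℝ} {x : ℕ → ℂ} : x ∈ dPlus p ↔ ∀ q, p < q → x ∈ dSpace q := by
  simp [dPlus, Submodule.mem_iInf]

/-- `d(p+)` as a type of its own. (The subtype `↥(dPlus p)` carries, as an instance, the topology
of coordinatewise convergence, which is not the topology of `d(p+)`.) -/
def DPlus (p : ℝ) : Type := ↥(dPlus p)

namespace DPlus

instance instAddCommGroup (p : ℝ) : AddCommGroup (DPlus p) :=
  inferInstanceAs (AddCommGroup ↥(dPlus p))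

instance instModule (p : ℝ) : Module ℂ (DPlus p) :=
  inferInstanceAs (Module ℂ ↥(dPlus p))

/-- The underlying sequence of an element of `d(p+)`. -/
def toSeq (p : ℝ) : DPlus p →ₗ[ℂ] (ℕ → ℂ) := (dPlus p).subtype

variable (p : ℝ) [hp : Fact (1 ≤ p)]

/-- The norm `x ↦ ‖x‖_{d(q)}` on `d(p+)`, for `q > p`. -/
def seminorm (q : Set.Ioi p) : Seminorm ℂ (DPlus p) :=
  Seminorm.of (fun x => dNorm q (toSeq p x))
    (fun x y => by
      rw [map_add]
      exact dNorm_add_le (lt_of_le_of_lt hp.out q.2) (mem_dPlus.1 x.2 q q.2)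
        (mem_dPlus.1 y.2 q q.2))
    (fun c x => by
      rw [map_smul]
      exact dNorm_smul (lt_of_le_of_lt hp.out q.2) c _)

instance instNonemptyIoi : Nonempty (Set.Ioi p) := ⟨⟨p + 1, by simp⟩⟩

/-- The locally convex topology of `d(p+)`, generated by the norms `‖·‖_{d(q)}`, `q > p`. -/
instance instTopologicalSpace : TopologicalSpace (DPlus p) :=
  SeminormFamily.moduleFilterBasis (seminorm p) |>.topology

theorem withSeminorms : WithSeminorms (seminorm p) := ⟨rfl⟩

instance instIsTopologicalAddGroup : IsTopologicalAddGroup (DPlus p) :=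
  (withSeminorms p).topologicalAddGroup

instance instContinuousSMul : ContinuousSMul ℂ (DPlus p) :=
  (withSeminorms p).continuousSMul

/-- The uniformity of `d(p+)` as a topological vector space: `x` and `y` are close
iff `x - y` is close to `0`. -/
instance instUniformSpace : UniformSpace (DPlus p) :=
  IsTopologicalAddGroup.rightUniformSpace (DPlus p)

instance instIsUniformAddGroup : IsUniformAddGroup (DPlus p) :=
  isUniformAddGroup_of_addCommGroup

end DPlus

theorem leastDecrMajorant_single (n m : ℕ) (h : n < m) :
    leastDecrMajorant (Pi.single n (1 : ℂ)) m = 0 := by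
  have hk : ∀ k : ℕ, ‖(Pi.single n (1 : ℂ) : ℕ → ℂ) (m + k)‖ = 0 := fun k => by
    rw [Pi.single_eq_of_ne (by omega), norm_zero]
  simp [leastDecrMajorant, hk]

theorem single_mem_dPlus {p : ℝ} (hp : 1 ≤ p) (n : ℕ) :
    (Pi.single n (1 : ℂ) : ℕ → ℂ) ∈ dPlus p := by
  refine mem_dPlus.2 fun q hq => ⟨memℓp_infty ⟨1, ?_⟩, ?_⟩
  · rintro _ ⟨k, rfl⟩
    by_cases h : k = n
    · subst h
      simp
    · simp [h]
  · have h0 : (0 : ℝ) < q := by linarith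
    refine memℓp_gen (summable_of_ne_finset_zero (s := Finset.range (n + 1)) fun m hm => ?_)
    rw [leastDecrMajorant_single n m (by simpa using hm), norm_zero,
      ENNReal.toReal_ofReal h0.le, Real.zero_rpow h0.ne']

/-- The canonical vector `e_n = (δ_{kn})_k` as an element of `d(p+)`. -/
def DPlus.canonicalVector (p : ℝ) [hp : Fact (1 ≤ p)] (n : ℕ) : DPlus p :=
  ⟨Pi.single n 1, single_mem_dPlus hp.out n⟩

/-- A Fréchet space: a metrizable, complete, locally convex topological vector space. -/
structure IsFrechetSpace (E : Type*) [AddCommGroup E] [Module ℂ E] [UniformSpace E]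
    [IsUniformAddGroup E] : Prop where
  continuousSMul : ContinuousSMul ℂ E
  locallyConvex : LocallyConvexSpace ℝ E
  metrizable : TopologicalSpace.MetrizableSpace E
  complete : CompleteSpace E

/-- `(e_n)` is an unconditional (Schauder) basis of `E`: there are continuous coordinate
functionals `f_n`, biorthogonal to `(e_n)`, such that `∑ f_n(x) e_n` converges unconditionally
to `x` for every `x`. (Biorthogonality and continuity of the `f_n` make the coefficients in any
convergent expansion of `x` unique.) -/
def IsUnconditionalBasis {E : Type*} [AddCommGroup E] [Module ℂ E] [TopologicalSpace E]
    (e : ℕ → E) : Prop :=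
  ∃ f : ℕ → (E →L[ℂ] ℂ), (∀ i j, f i (e j) = if i = j then 1 else 0) ∧
    ∀ x, HasSum (fun n => f n x • e n) x

/-- `E` is reflexive: the canonical evaluation map `x ↦ (f ↦ f x)` is a topological isomorphism of
`E` onto its strong bidual. (The topology on spaces of continuous linear maps is that of uniform
convergence on bounded sets.) -/
def IsReflexiveLCS (E : Type*) [AddCommGroup E] [Module ℂ E] [TopologicalSpace E] : Prop :=
  ∃ J : E ≃L[ℂ] ((E →L[ℂ] ℂ) →L[ℂ] ℂ), ∀ (x : E) (f : E →L[ℂ] ℂ), J x f = f x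

end

/-! Since `x̂` is decreasing, `(n + 1) * x̂_n ^ q ≤ ‖x̂‖_q ^ q`, so the `d(q)`-norm dominates the
sup-norm weighted by `(n + 1) ^ (1 / q)`. Conversely, for `r < q` a bound `|x_n| ≤ M (n + 1) ^ (-1 /
r)` passes to `x̂` and makes it `q`-summable. Because the intersection runs over the open interval
`q > p`, this loss of exponent is harmless, and `d(p+)` is a Köthe echelon space of sup type with
these weights.

For `r < q` the weight ratio decreases to `0`, so tails are small uniformly on bounded sets
(`exists_seminorm_tail_le`). This gives the unconditional basis, and it makes the coordinate
expansion of each functional converge in the strong dual (`tendsto_sum_smul_coord`). An element `φ`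
of the bidual is therefore determined by the sequence `φ (coord p n)`. That sequence lies in `d(p+)`
because the weighted coordinate functionals form a strongly bounded set. Evaluation is continuous by
Banach–Steinhaus, and its inverse by testing on the same bounded sets. -/

/-! ### Weighted sup-norms versus the norms of `d(q)` -/

/-- The weight `(n + 1) ^ (1 / q)`: the weighted sup-norms with these weights generate the topology
of `d(p+)`. -/
noncomputable def powWeight (q : ℝ) (n : ℕ) : ℝ := ((n : ℝ) + 1) ^ (1 / q)

theorem powWeight_pos (q : ℝ) (n : ℕ) : 0 < powWeight q n := by
  unfold powWeight; positivity

theorem powWeight_rpow {q : ℝ} (hq : 0 < q) (n : ℕ) : powWeight q n ^ q = (n : ℝ) + 1 := by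
  rw [powWeight, one_div, Real.rpow_inv_rpow (by positivity) hq.ne']

theorem powWeight_mono {q : ℝ} (hq : 0 < q) : Monotone (powWeight q) := by
  intro m n h
  unfold powWeight
  gcongr

theorem tendsto_powWeight_div {q r : ℝ} (hr : 0 < r) (h : r < q) :
    Tendsto (fun n => powWeight q n / powWeight r n) atTop (𝓝 0) := by
  have hd : 0 < 1 / r - 1 / q := sub_pos.2 (one_div_lt_one_div_of_lt hr h)
  have h1 : Tendsto (fun n : ℕ => (n : ℝ) + 1) atTop atTop :=
    tendsto_atTop_add_const_right _ _ tendsto_natCast_atTop_atTop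
  refine ((tendsto_rpow_neg_atTop hd).comp h1).congr fun n => ?_
  have : (0 : ℝ) < (n : ℝ) + 1 := by positivity
  rw [Function.comp_apply, neg_sub, Real.rpow_sub this, powWeight, powWeight]

theorem powWeight_div_antitone {q r : ℝ} (hr : 0 < r) (h : r < q) :
    Antitone fun n => powWeight q n / powWeight r n := by
  have hd : 0 < 1 / r - 1 / q := sub_pos.2 (one_div_lt_one_div_of_lt hr h)
  have key : ∀ n : ℕ, powWeight q n / powWeight r n = ((n : ℝ) + 1) ^ (-(1 / r - 1 / q)) := by
    intro n
    rw [neg_sub, Real.rpow_sub (by positivity), powWeight, powWeight]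
  intro m n hmn
  simp only [key]
  exact Real.rpow_le_rpow_of_nonpos (by positivity) (by gcongr) (by linarith)

theorem norm_le_leastDecrMajorant {x : ℕ → ℂ} (hx : Memℓp x ∞) {m n : ℕ} (h : m ≤ n) :
    ‖x n‖ ≤ leastDecrMajorant x m := by
  obtain ⟨k, rfl⟩ := Nat.exists_eq_add_of_le h
  exact le_ciSup (bddAbove_tail hx m) k

/-- Each of the `n + 1` terms `x̂_0, …, x̂_n` is at least `|x_n|`. -/
theorem norm_mul_powWeight_le_dNorm {q : ℝ} (hq : 1 < q) {x : ℕ → ℂ} (hx : x ∈ dSpace q) (n : ℕ) :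
    ‖x n‖ * powWeight q n ≤ dNorm q x := by
  have h0 : 0 < q := by linarith
  have h1 : (‖x n‖ * powWeight q n) ^ q ≤ ∑' k, leastDecrMajorant x k ^ q := by
    rw [Real.mul_rpow (norm_nonneg _) (powWeight_pos q n).le, powWeight_rpow h0]
    calc ‖x n‖ ^ q * ((n : ℝ) + 1) = ∑ _k ∈ Finset.range (n + 1), ‖x n‖ ^ q := by
          simp [mul_comm]
      _ ≤ ∑ k ∈ Finset.range (n + 1), leastDecrMajorant x k ^ q := by
          refine Finset.sum_le_sum fun k hk => ?_
          have hk' : k ≤ n := Nat.lt_succ_iff.1 (Finset.mem_range.1 hk)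
          exact Real.rpow_le_rpow (norm_nonneg _) (norm_le_leastDecrMajorant hx.1 hk') h0.le
      _ ≤ _ := (summable_of_mem_dSpace hq hx).sum_le_tsum _ fun k _ =>
          Real.rpow_nonneg (leastDecrMajorant_nonneg x k) q
  have h2 : 0 ≤ ‖x n‖ * powWeight q n := mul_nonneg (norm_nonneg _) (powWeight_pos q n).le
  rw [dNorm, one_div]
  exact (Real.le_rpow_inv_iff_of_pos h2 (tsum_nonneg fun k =>
    Real.rpow_nonneg (leastDecrMajorant_nonneg x k) q) h0).2 h1

/-- The exponent `q / r` exceeds `1`; this is where strictness of `r < q` enters the comparison of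
norms. -/
theorem summable_powWeight {q r : ℝ} (hr : 0 < r) (h : r < q) :
    Summable fun n => ((powWeight r n)⁻¹) ^ q := by
  refine ((Real.summable_one_div_nat_add_rpow 1 (q / r)).2 ((one_lt_div hr).2 h)).congr
    fun n => ?_
  have h1 : (0 : ℝ) < (n : ℝ) + 1 := by positivity
  rw [abs_of_pos h1, powWeight, Real.inv_rpow (by positivity), ← Real.rpow_mul h1.le, one_div]
  congr 2
  ring

theorem leastDecrMajorant_le_of_bound {r M : ℝ} (hr : 0 < r) {x : ℕ → ℂ}
    (hx : ∀ n, ‖x n‖ * powWeight r n ≤ M) (n : ℕ) :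
    leastDecrMajorant x n ≤ M * (powWeight r n)⁻¹ := by
  refine ciSup_le fun k => ?_
  rw [← div_eq_mul_inv, le_div_iff₀ (powWeight_pos r n)]
  refine le_trans ?_ (hx (n + k))
  gcongr
  exact powWeight_mono hr (Nat.le_add_right n k)

theorem leastDecrMajorant_rpow_le_of_bound {q r M : ℝ} (hr : 0 < r) (h : r < q) {x : ℕ → ℂ}
    (hx : ∀ n, ‖x n‖ * powWeight r n ≤ M) (n : ℕ) :
    leastDecrMajorant x n ^ q ≤ M ^ q * ((powWeight r n)⁻¹) ^ q := by
  have hM : 0 ≤ M := (mul_nonneg (norm_nonneg _) (powWeight_pos r 0).le).trans (hx 0)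
  rw [← Real.mul_rpow hM (inv_nonneg.2 (powWeight_pos r n).le)]
  exact Real.rpow_le_rpow (leastDecrMajorant_nonneg x n) (leastDecrMajorant_le_of_bound hr hx n)
    (hr.trans h).le

theorem mem_dSpace_of_bound {q r M : ℝ} (hr : 0 < r) (h : r < q) {x : ℕ → ℂ}
    (hx : ∀ n, ‖x n‖ * powWeight r n ≤ M) : x ∈ dSpace q := by
  have hq : 0 < q := hr.trans h
  refine ⟨memℓp_infty ⟨M, ?_⟩, memℓp_gen ?_⟩
  · rintro _ ⟨n, rfl⟩
    refine le_trans (le_mul_of_one_le_right (norm_nonneg _) ?_) (hx n)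
    exact Real.one_le_rpow (by linarith [(Nat.cast_nonneg n : (0 : ℝ) ≤ n)]) (by positivity)
  · rw [ENNReal.toReal_ofReal hq.le]
    refine Summable.of_nonneg_of_le (fun n => by positivity) (fun n => ?_)
      ((summable_powWeight hr h).mul_left (M ^ q))
    rw [Real.norm_of_nonneg (leastDecrMajorant_nonneg x n)]
    exact leastDecrMajorant_rpow_le_of_bound hr h hx n

theorem dNorm_le_of_bound {q r M : ℝ} (hr : 0 < r) (h : r < q) {x : ℕ → ℂ}
    (hx : ∀ n, ‖x n‖ * powWeight r n ≤ M) :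
    dNorm q x ≤ (∑' n, ((powWeight r n)⁻¹) ^ q) ^ (1 / q) * M := by
  have hq : 0 < q := hr.trans h
  have hM : 0 ≤ M := (mul_nonneg (norm_nonneg _) (powWeight_pos r 0).le).trans (hx 0)
  have hs := (summable_powWeight hr h).mul_left (M ^ q)
  have h0 : ∀ n, 0 ≤ leastDecrMajorant x n ^ q := fun n =>
    Real.rpow_nonneg (leastDecrMajorant_nonneg x n) q
  have h1 : ∑' n, leastDecrMajorant x n ^ q ≤ M ^ q * ∑' n, ((powWeight r n)⁻¹) ^ q := by
    rw [← tsum_mul_left]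
    exact Summable.tsum_le_tsum (leastDecrMajorant_rpow_le_of_bound hr h hx)
      (Summable.of_nonneg_of_le h0 (leastDecrMajorant_rpow_le_of_bound hr h hx) hs) hs
  refine (Real.rpow_le_rpow (tsum_nonneg h0) h1 (by positivity)).trans_eq ?_
  rw [Real.mul_rpow (Real.rpow_nonneg hM q) (tsum_nonneg fun n =>
      Real.rpow_nonneg (inv_nonneg.2 (powWeight_pos r n).le) q), one_div,
    Real.rpow_rpow_inv hM hq.ne', mul_comm]

theorem mem_dPlus_iff_bound {p : ℝ} (hp : 1 ≤ p) {x : ℕ → ℂ} :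
    x ∈ dPlus p ↔ ∀ q, p < q → ∃ M, ∀ n, ‖x n‖ * powWeight q n ≤ M := by
  rw [mem_dPlus]
  refine ⟨fun h q hq => ⟨_, norm_mul_powWeight_le_dNorm (hp.trans_lt hq) (h q hq)⟩,
    fun h q hq => ?_⟩
  obtain ⟨r, hpr, hrq⟩ := exists_between hq
  obtain ⟨M, hM⟩ := h r hpr
  exact mem_dSpace_of_bound (by linarith) hrq hM

theorem dPlus_lt_dPlus {p q : ℝ} (hp : 1 ≤ p) (h : p < q) : dPlus p < dPlus q := by
  have hq : 1 ≤ q := hp.trans h.le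
  refine SetLike.lt_iff_le_and_exists.2
    ⟨fun x hx => mem_dPlus.2 fun r hr => mem_dPlus.1 hx r (h.trans hr),
      -- The sequence `(n + 1) ^ (-1 / q)` separates the spaces: its decay is too slow for every
      -- exponent in `(p, q)`.
      fun n => (((powWeight q n)⁻¹ : ℝ) : ℂ), ?_, ?_⟩
  · refine (mem_dPlus_iff_bound hq).2 fun r hr => ⟨powWeight r 0 / powWeight q 0, fun n => ?_⟩
    rw [Complex.norm_of_nonneg (inv_nonneg.2 (powWeight_pos q n).le), ← div_eq_inv_mul]
    exact powWeight_div_antitone (by linarith) hr (Nat.zero_le n)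
  · intro hx
    obtain ⟨r, hpr, hrq⟩ := exists_between h
    obtain ⟨M, hM⟩ := (mem_dPlus_iff_bound hp).1 hx r hpr
    have hr0 : 0 < r := by linarith
    have h1 : ∀ n, 1 ≤ M * (powWeight q n / powWeight r n) := by
      intro n
      have := hM n
      rw [Complex.norm_of_nonneg (inv_nonneg.2 (powWeight_pos q n).le), ← div_eq_inv_mul,
        div_le_iff₀ (powWeight_pos q n)] at this
      rw [← mul_div_assoc, one_le_div (powWeight_pos r n)]
      exact this
    have h2 := ge_of_tendsto' ((tendsto_powWeight_div hr0 hrq).const_mul M) h1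
    rw [mul_zero] at h2
    linarith

/-! ### Topology and completeness of `d(p+)` -/

namespace DPlus

theorem toSeq_injective {p : ℝ} : Function.Injective (toSeq p) := Subtype.val_injective

theorem exists_lt_Ioi {p : ℝ} (q : Set.Ioi p) : ∃ r : Set.Ioi p, r < q := by
  obtain ⟨r, h1, h2⟩ := exists_between (Set.mem_Ioi.1 q.2)
  exact ⟨⟨r, h1⟩, h2⟩

variable {p : ℝ} [hp : Fact (1 ≤ p)]

theorem pos_of_mem_Ioi (q : Set.Ioi p) : 0 < (q : ℝ) := by
  have h1 : p < q := q.2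
  linarith [hp.out]

theorem norm_mul_powWeight_le_seminorm (q : Set.Ioi p) (x : DPlus p) (n : ℕ) :
    ‖toSeq p x n‖ * powWeight q n ≤ seminorm p q x :=
  norm_mul_powWeight_le_dNorm (lt_of_le_of_lt hp.out q.2) (mem_dPlus.1 x.2 q q.2) n

theorem exists_seminorm_le_of_bound {r q : Set.Ioi p} (h : r < q) :
    ∃ C : NNReal, ∀ (x : DPlus p) (M : ℝ), (∀ n, ‖toSeq p x n‖ * powWeight r n ≤ M) →
      seminorm p q x ≤ C * M :=
  ⟨⟨(∑' n, ((powWeight r n)⁻¹) ^ (q : ℝ)) ^ (1 / (q : ℝ)), Real.rpow_nonneg (tsum_nonneg fun n =>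
      Real.rpow_nonneg (inv_nonneg.2 (powWeight_pos r n).le) q) _⟩,
    fun _ _ hx => dNorm_le_of_bound (pos_of_mem_Ioi r) h hx⟩

theorem exists_seminorm_le {r q : Set.Ioi p} (h : r < q) :
    ∃ C : NNReal, seminorm p q ≤ C • seminorm p r := by
  obtain ⟨C, hC⟩ := exists_seminorm_le_of_bound h
  exact ⟨C, fun x => hC x _ (norm_mul_powWeight_le_seminorm r x)⟩

/-- The norms are directed up to constants: an exponent below finitely many others dominates all of
them. -/
theorem exists_finset_sup_le (s : Finset (Set.Ioi p)) :
    ∃ (q : Set.Ioi p) (C : NNReal), s.sup (seminorm p) ≤ C • seminorm p q := by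
  classical
  induction s using Finset.induction_on with
  | empty => exact ⟨Classical.arbitrary _, 0, by simp⟩
  | insert a s _ ih =>
    obtain ⟨q, C, hC⟩ := ih
    obtain ⟨r, hr⟩ := exists_lt_Ioi (a ⊓ q)
    obtain ⟨A, hA⟩ := exists_seminorm_le (hr.trans_le inf_le_left)
    obtain ⟨B, hB⟩ := exists_seminorm_le (hr.trans_le inf_le_right)
    refine ⟨r, A + C * B, ?_⟩
    rw [Finset.sup_insert]
    refine sup_le (hA.trans fun x => ?_) (hC.trans fun x => ?_)
    · have h0 : 0 ≤ seminorm p r x := apply_nonneg _ x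
      have : (A : ℝ) * seminorm p r x ≤ (A + C * B) * seminorm p r x := by
        gcongr
        exact le_add_of_nonneg_right (by positivity)
      simpa [NNReal.smul_def] using! this
    · have h0 : 0 ≤ seminorm p r x := apply_nonneg _ x
      have h1 : seminorm p q x ≤ B * seminorm p r x := hB x
      have : (C : ℝ) * seminorm p q x ≤ (A + C * B) * seminorm p r x := by
        calc (C : ℝ) * seminorm p q x ≤ C * (B * seminorm p r x) := by gcongr
          _ ≤ (A + C * B) * seminorm p r x := by
            rw [← mul_assoc]
            gcongr
            exact le_add_of_nonneg_left A.2
      simpa [NNReal.smul_def] using! this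

theorem exists_norm_apply_le (g : DPlus p →L[ℂ] ℂ) :
    ∃ (q : Set.Ioi p) (C : NNReal), ∀ x, ‖g x‖ ≤ C * seminorm p q x := by
  obtain ⟨s, A, -, hA⟩ := Seminorm.bound_of_continuous (withSeminorms p)
    ((normSeminorm ℂ ℂ).comp g.toLinearMap) (continuous_norm.comp g.continuous)
  obtain ⟨q, C, hC⟩ := exists_finset_sup_le s
  refine ⟨q, A * C, fun x => ?_⟩
  calc ‖g x‖ ≤ A * s.sup (seminorm p) x := hA x
    _ ≤ A * (C * seminorm p q x) := by gcongr; exact hC x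
    _ = _ := by rw [NNReal.coe_mul, mul_assoc]

theorem withSeminorms_of_tendsto {r : ℕ → Set.Ioi p}
    (hr : Tendsto (fun k => (r k : ℝ)) atTop (𝓝 p)) :
    WithSeminorms fun k => seminorm p (r k) := by
  refine (withSeminorms p).congr (fun k => ⟨{r k}, 1, by simp⟩) fun q => ?_
  obtain ⟨k, hk⟩ := (hr.eventually_lt_const (Set.mem_Ioi.1 q.2)).exists
  obtain ⟨C, hC⟩ := exists_seminorm_le (r := r k) (q := q) hk
  exact ⟨{k}, C, by simpa using! hC⟩

theorem exists_seq_tendsto (p : ℝ) :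
    ∃ r : ℕ → Set.Ioi p, Tendsto (fun k => (r k : ℝ)) atTop (𝓝 p) := by
  obtain ⟨u, -, hu, h⟩ := exists_seq_strictAnti_tendsto p
  exact ⟨fun k => ⟨u k, hu k⟩, h⟩

instance instT1Space : T1Space (DPlus p) := by
  refine (withSeminorms p).T1_of_separating fun x hx => ⟨Classical.arbitrary _, fun h => hx ?_⟩
  refine toSeq_injective (funext fun n => ?_)
  have h1 := norm_mul_powWeight_le_seminorm (Classical.arbitrary (Set.Ioi p)) x n
  rw [h] at h1
  have := nonpos_of_mul_nonpos_left h1 (powWeight_pos _ n)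
  simpa using this

/-- Yields metrizability, completeness by sequences and, through Baire, the barrelledness required
by `bidualEval`. -/
instance instIsCountablyGenerated : (uniformity (DPlus p)).IsCountablyGenerated := by
  obtain ⟨r, hr⟩ := exists_seq_tendsto p
  have := (withSeminorms_of_tendsto hr).firstCountableTopology
  exact IsUniformAddGroup.uniformity_countably_generated

/-- The `n`-th coordinate as a continuous linear functional. -/
noncomputable def coord (p : ℝ) [hp : Fact (1 ≤ p)] (n : ℕ) : DPlus p →L[ℂ] ℂ where
  toLinearMap := (LinearMap.proj n).comp (toSeq p)
  cont := by
    let q : Set.Ioi p := Classical.arbitrary _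
    refine (withSeminorms p).continuous_normedSpace_rng ℂ _
      ⟨{q}, ⟨(powWeight q n)⁻¹, inv_nonneg.2 (powWeight_pos q n).le⟩, fun x => ?_⟩
    have := norm_mul_powWeight_le_seminorm q x n
    rw [← le_div_iff₀ (powWeight_pos q n), div_eq_inv_mul] at this
    simpa [NNReal.smul_def] using! this

@[simp] theorem coord_apply (n : ℕ) (x : DPlus p) : coord p n x = toSeq p x n := rfl

theorem tendsto_iff {ι : Type*} {l : Filter ι} {u : ι → DPlus p} {x : DPlus p} :
    Tendsto u l (𝓝 x) ↔ ∀ q, ∀ ε > 0, ∀ᶠ i in l, seminorm p q (u i - x) < ε :=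
  (withSeminorms p).tendsto_nhds u x

theorem tendsto_of_bound {ι : Type*} {l : Filter ι} {u : ι → DPlus p} {x : DPlus p}
    (h : ∀ r : Set.Ioi p, ∀ ε > 0, ∀ᶠ i in l,
      ∀ n, ‖toSeq p (u i) n - toSeq p x n‖ * powWeight r n ≤ ε) :
    Tendsto u l (𝓝 x) := by
  refine tendsto_iff.2 fun q ε hε => ?_
  obtain ⟨r, hr⟩ := exists_lt_Ioi q
  obtain ⟨C, hC⟩ := exists_seminorm_le_of_bound hr
  -- `C` may vanish, so `C + 1` serves as the divisor and also makes the final inequality strict.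
  have hC' : (0 : ℝ) < C + 1 := by positivity
  filter_upwards [h r (ε / (C + 1)) (by positivity)] with i hi
  refine (hC (u i - x) _ (by simpa only [map_sub, Pi.sub_apply] using hi)).trans_lt ?_
  rw [← mul_div_assoc, div_lt_iff₀ hC', mul_comm]
  gcongr
  linarith

instance instCompleteSpace : CompleteSpace (DPlus p) := by
  refine UniformSpace.complete_of_cauchySeq_tendsto fun u hu => ?_
  have hcoord : ∀ n, ∃ a : ℂ, Tendsto (fun i => toSeq p (u i) n) atTop (𝓝 a) := fun n =>
    cauchySeq_tendsto_of_complete (hu.map (coord p n).uniformContinuous)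
  choose a ha using hcoord
  have hdiff : Tendsto (fun m : ℕ × ℕ => u m.1 - u m.2) atTop (𝓝 0) := by
    have := hu
    rw [CauchySeq, cauchy_map_iff, uniformity_eq_comap_nhds_zero_swapped] at this
    rw [← prod_atTop_atTop_eq]
    simpa [tendsto_comap_iff, Function.comp_def] using this.2
  have key : ∀ r : Set.Ioi p, ∀ ε > 0, ∃ N, ∀ i ≥ N, ∀ n,
      ‖toSeq p (u i) n - a n‖ * powWeight r n ≤ ε := by
    intro r ε hε
    obtain ⟨⟨N₁, N₂⟩, hN⟩ := eventually_atTop.1 (tendsto_iff.1 hdiff r ε hε)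
    refine ⟨max N₁ N₂, fun i hi n => ?_⟩
    have hlim : Tendsto (fun j => ‖toSeq p (u i) n - toSeq p (u j) n‖ * powWeight r n) atTop
        (𝓝 (‖toSeq p (u i) n - a n‖ * powWeight r n)) :=
      ((tendsto_const_nhds.sub (ha n)).norm).mul_const _
    -- With `i` fixed, letting `j → ∞` keeps the Cauchy bound uniform in `n`.
    refine le_of_tendsto hlim (eventually_atTop.2 ⟨N₂, fun j hj => ?_⟩)
    have h1 := hN (i, j) ⟨(le_max_left _ _).trans hi, hj⟩
    rw [sub_zero] at h1
    refine le_trans ?_ h1.le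
    simpa only [map_sub, Pi.sub_apply] using norm_mul_powWeight_le_seminorm r (u i - u j) n
  have hmem : a ∈ dPlus p := by
    refine (mem_dPlus_iff_bound hp.out).2 fun q hq => ?_
    obtain ⟨N, hN⟩ := key ⟨q, hq⟩ 1 one_pos
    refine ⟨seminorm p ⟨q, hq⟩ (u N) + 1, fun n => ?_⟩
    have h1 := norm_mul_powWeight_le_seminorm ⟨q, hq⟩ (u N) n
    have h2 := hN N le_rfl n
    have h3 : ‖a n‖ ≤ ‖toSeq p (u N) n‖ + ‖toSeq p (u N) n - a n‖ := by
      rw [norm_sub_rev]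
      simpa using norm_add_le (toSeq p (u N) n) (a n - toSeq p (u N) n)
    calc ‖a n‖ * powWeight q n
        ≤ (‖toSeq p (u N) n‖ + ‖toSeq p (u N) n - a n‖) * powWeight q n := by
          gcongr; exact (powWeight_pos q n).le
      _ ≤ _ := by rw [add_mul]; exact add_le_add h1 h2
  exact ⟨⟨a, hmem⟩, tendsto_of_bound fun r ε hε => eventually_atTop.2 (key r ε hε)⟩

theorem isFrechetSpace : IsFrechetSpace (DPlus p) where
  continuousSMul := inferInstance
  locallyConvex := (withSeminorms p).toLocallyConvexSpace
  metrizable := inferInstance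
  complete := inferInstance

/-! ### Uniform tail estimates, basis and separability -/

/-- Two strict steps `s < r < q` are spent: `r < q` turns a weighted sup bound into a norm bound,
and `s < r` supplies the decaying factor. The weight ratio is antitone, so its largest value on `n ≥
N` is the one at `N`. -/
theorem exists_seminorm_tail_le (q : Set.Ioi p) :
    ∃ (s : Set.Ioi p) (b : ℕ → ℝ), Tendsto b atTop (𝓝 0) ∧ ∀ (N : ℕ) (x y : DPlus p),
      (∀ n < N, toSeq p y n = 0) → (∀ n, ‖toSeq p y n‖ ≤ ‖toSeq p x n‖) →
      seminorm p q y ≤ b N * seminorm p s x := by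
  obtain ⟨r, hr⟩ := exists_lt_Ioi q
  obtain ⟨s, hs⟩ := exists_lt_Ioi r
  obtain ⟨C, hC⟩ := exists_seminorm_le_of_bound hr
  refine ⟨s, fun N => C * (powWeight r N / powWeight s N), ?_, fun N x y hy hxy => ?_⟩
  · simpa using (tendsto_powWeight_div (pos_of_mem_Ioi s) hs).const_mul (C : ℝ)
  · rw [mul_assoc]
    refine hC y _ fun n => ?_
    have hN : 0 < powWeight r N / powWeight s N := div_pos (powWeight_pos _ _) (powWeight_pos _ _)
    rcases lt_or_ge n N with h | h
    · rw [hy n h, norm_zero, zero_mul]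
      exact mul_nonneg hN.le (apply_nonneg _ x)
    · have hw := powWeight_pos (s : ℝ) n
      calc ‖toSeq p y n‖ * powWeight r n
          = (powWeight r n / powWeight s n) * (‖toSeq p y n‖ * powWeight s n) := by
            field_simp
        _ ≤ (powWeight r N / powWeight s N) * (‖toSeq p x n‖ * powWeight s n) :=
            mul_le_mul (powWeight_div_antitone (pos_of_mem_Ioi s) hs h)
              (mul_le_mul_of_nonneg_right (hxy n) hw.le)
              (mul_nonneg (norm_nonneg _) hw.le) hN.le
        _ ≤ _ := by
            gcongr
            exact norm_mul_powWeight_le_seminorm s x n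

theorem toSeq_canonicalVector (n : ℕ) : toSeq p (canonicalVector p n) = Pi.single n 1 := rfl

theorem toSeq_sum_smul_canonicalVector (s : Finset ℕ) (c : ℕ → ℂ) (k : ℕ) :
    toSeq p (∑ n ∈ s, c n • canonicalVector p n) k = if k ∈ s then c k else 0 := by
  simp [map_sum, toSeq_canonicalVector, Finset.sum_apply, Pi.single_apply]

/-- Uniformity in `t` gives unconditional convergence; uniformity in `x` on bounded sets gives
convergence in the strong dual. -/
theorem exists_seminorm_sub_sum_le (q : Set.Ioi p) :
    ∃ (s : Set.Ioi p) (b : ℕ → ℝ), Tendsto b atTop (𝓝 0) ∧ ∀ (N : ℕ) (t : Finset ℕ) (x : DPlus p),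
      Finset.range N ⊆ t →
      seminorm p q (∑ n ∈ t, toSeq p x n • canonicalVector p n - x) ≤ b N * seminorm p s x := by
  obtain ⟨s, b, hb, h⟩ := exists_seminorm_tail_le q
  refine ⟨s, b, hb, fun N t x ht => h N x _ (fun n hn => ?_) fun n => ?_⟩
  · have : n ∈ t := ht (Finset.mem_range.2 hn)
    rw [map_sub, Pi.sub_apply, toSeq_sum_smul_canonicalVector, if_pos this, sub_self]
  · rw [map_sub, Pi.sub_apply, toSeq_sum_smul_canonicalVector]
    by_cases hn : n ∈ t <;> simp [hn]

theorem hasSum_coord_smul_canonicalVector (x : DPlus p) :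
    HasSum (fun n => coord p n x • canonicalVector p n) x := by
  refine tendsto_iff.2 fun q ε hε => ?_
  obtain ⟨s, b, hb, h⟩ := exists_seminorm_sub_sum_le q
  have hb' : Tendsto (fun N => b N * seminorm p s x) atTop (𝓝 0) := by
    simpa using hb.mul_const (seminorm p s x)
  obtain ⟨N, hN⟩ := (hb'.eventually_lt_const hε).exists
  exact (eventually_ge_atTop (Finset.range N)).mono fun t ht => (h N t x ht).trans_lt hN

theorem isUnconditionalBasis_canonicalVector : IsUnconditionalBasis (canonicalVector p) :=
  ⟨coord p, fun i j => by simp [toSeq_canonicalVector, Pi.single_apply],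
    hasSum_coord_smul_canonicalVector⟩

instance instSeparableSpace : TopologicalSpace.SeparableSpace (DPlus p) := by
  have hs : TopologicalSpace.IsSeparable (Submodule.span ℂ (Set.range (canonicalVector p)) :
      Set (DPlus p)) := (Set.countable_range _).isSeparable.span
  refine TopologicalSpace.isSeparable_univ_iff.1 (hs.closure.mono fun x _ => ?_)
  exact mem_closure_of_tendsto (hasSum_coord_smul_canonicalVector x) (Eventually.of_forall fun t =>
    Submodule.sum_mem _ fun n _ => Submodule.smul_mem _ _ (Submodule.subset_span ⟨n, rfl⟩))

end DPlus

/-! ### Evaluation into the strong bidual -/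

/-- The canonical evaluation map into the bidual, as a linear map. -/
noncomputable def bidualEvalLinearMap (E : Type*) [AddCommGroup E] [Module ℂ E] [TopologicalSpace E]
    [IsTopologicalAddGroup E] [ContinuousSMul ℂ E] : E →ₗ[ℂ] ((E →L[ℂ] ℂ) →L[ℂ] ℂ) where
  toFun x :=
    { toFun := fun f => f x
      map_add' := fun _ _ => rfl
      map_smul' := fun _ _ => rfl
      cont := continuous_eval_const x }
  map_add' x y := by ext f; exact map_add f x y
  map_smul' c x := by ext f; exact map_smul f c x

/-- The canonical evaluation map of a barrelled space into its strong bidual. -/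
noncomputable def bidualEval (E : Type*) [AddCommGroup E] [Module ℂ E] [UniformSpace E]
    [IsUniformAddGroup E] [ContinuousSMul ℂ E] [BarrelledSpace ℂ E] :
    E →L[ℂ] ((E →L[ℂ] ℂ) →L[ℂ] ℂ) where
  toLinearMap := bidualEvalLinearMap E
  cont := by
    have htop : IsTopologicalAddGroup ((E →L[ℂ] ℂ) →L[ℂ] ℂ) := inferInstance
    have : ContinuousAdd ((E →L[ℂ] ℂ) →L[ℂ] ℂ) := htop.toContinuousAdd
    refine continuous_of_tendsto_nhds_zero (bidualEvalLinearMap E) ?_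
    refine (ContinuousLinearMap.hasBasis_nhds_zero_of_basis
      (Metric.nhds_basis_ball (x := (0 : ℂ)))).tendsto_right_iff.2 ?_
    rintro ⟨S, ε⟩ ⟨hS, hε⟩
    -- A strongly bounded set of functionals is pointwise bounded (test on singletons), hence
    -- equicontinuous by barrelledness.
    have hequi : UniformEquicontinuous fun (g : S) (x : E) => (g : E →L[ℂ] ℂ) x := by
      refine WithSeminorms.banach_steinhaus (𝓕 := fun g : S => (g : E →L[ℂ] ℂ))
        (norm_withSeminorms ℂ ℂ) fun _ x => ?_
      obtain ⟨C, hC⟩ := (NormedSpace.isVonNBounded_iff' ℂ).1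
        (ContinuousLinearMap.isVonNBounded_image2_apply hS (Bornology.isVonNBounded_singleton x))
      refine ⟨C, ?_⟩
      rintro _ ⟨g, rfl⟩
      exact hC _ ⟨g, g.2, x, rfl, rfl⟩
    filter_upwards [Metric.equicontinuousAt_iff_right.1 (hequi.equicontinuous 0) ε hε] with x hx g hg
    simpa [bidualEvalLinearMap, dist_comm] using hx ⟨g, hg⟩

@[simp] theorem bidualEval_apply {E : Type*} [AddCommGroup E] [Module ℂ E] [UniformSpace E]
    [IsUniformAddGroup E] [ContinuousSMul ℂ E] [BarrelledSpace ℂ E] (x : E) (f : E →L[ℂ] ℂ) :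
    bidualEval E x f = f x := rfl

/-! ### Reflexivity of `d(p+)` -/

namespace DPlus

variable {p : ℝ} [hp : Fact (1 ≤ p)]

theorem isVonNBounded_range_powWeight_smul_coord (q : Set.Ioi p) :
    Bornology.IsVonNBounded ℂ (Set.range fun n => (powWeight q n : ℂ) • coord p n) := by
  refine ContinuousLinearMap.isVonNBounded_iff.2 fun s hs => ?_
  obtain ⟨r, -, hr⟩ := (withSeminorms p).isVonNBounded_iff_seminorm_bounded.1 hs q
  refine (NormedSpace.isVonNBounded_iff' ℂ).2 ⟨r, ?_⟩
  rintro _ ⟨_, ⟨n, rfl⟩, x, hx, rfl⟩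
  simpa [abs_of_pos (powWeight_pos q n), mul_comm] using
    (norm_mul_powWeight_le_seminorm q x n).trans (hr x hx).le

theorem tendsto_sum_smul_coord (g : DPlus p →L[ℂ] ℂ) :
    Tendsto (fun N => ∑ n ∈ Finset.range N, g (canonicalVector p n) • coord p n) atTop (𝓝 g) := by
  refine tendsto_sub_nhds_zero_iff.1 ?_
  refine (ContinuousLinearMap.hasBasis_nhds_zero_of_basis
    (Metric.nhds_basis_ball (x := (0 : ℂ)))).tendsto_right_iff.2 ?_
  rintro ⟨S, ε⟩ ⟨hS, hε⟩
  obtain ⟨q, C, hC⟩ := exists_norm_apply_le g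
  obtain ⟨s, b, hb, h⟩ := exists_seminorm_sub_sum_le q
  obtain ⟨r, hr0, hr⟩ := (withSeminorms p).isVonNBounded_iff_seminorm_bounded.1 hS s
  have hb' : Tendsto (fun N => C * (|b N| * r)) atTop (𝓝 0) := by
    simpa using (hb.abs.mul_const r).const_mul (C : ℝ)
  filter_upwards [hb'.eventually_lt_const hε] with N hN x hx
  -- The partial sums of `g` are `g` composed with the basis projections.
  have key : (∑ n ∈ Finset.range N, g (canonicalVector p n) • coord p n - g) x =
      g (∑ n ∈ Finset.range N, toSeq p x n • canonicalVector p n - x) := by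
    simp [map_sum, mul_comm]
  rw [mem_ball_zero_iff, key]
  calc _ ≤ C * seminorm p q _ := hC _
    _ ≤ C * (|b N| * r) := by
      gcongr
      refine (h N _ x subset_rfl).trans ?_
      exact mul_le_mul (le_abs_self _) (hr x hx).le (apply_nonneg _ x) (abs_nonneg _)
    _ < ε := hN

/-- The preimage must have coordinates `φ (coord p n)`. Evaluation at it agrees with `φ` on the
coordinate functionals, whose span is strongly dense. -/
theorem exists_bidualEval_eq (φ : (DPlus p →L[ℂ] ℂ) →L[ℂ] ℂ) :
    ∃ x : DPlus p, bidualEval (DPlus p) x = φ := by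
  have hmem : (fun n => φ (coord p n)) ∈ dPlus p := by
    refine (mem_dPlus_iff_bound hp.out).2 fun q hq => ?_
    obtain ⟨M, hM⟩ := (NormedSpace.isVonNBounded_iff' ℂ).1
      ((isVonNBounded_range_powWeight_smul_coord ⟨q, hq⟩).image φ)
    refine ⟨M, fun n => ?_⟩
    simpa [abs_of_pos (powWeight_pos q n), mul_comm] using hM _ ⟨_, ⟨n, rfl⟩, rfl⟩
  let x : DPlus p := ⟨_, hmem⟩
  have hx : ∀ n, coord p n x = φ (coord p n) := fun n => rfl
  refine ⟨x, ContinuousLinearMap.ext fun g => ?_⟩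
  have hlim : ∀ ψ : (DPlus p →L[ℂ] ℂ) →L[ℂ] ℂ, Tendsto
      (fun N => ∑ n ∈ Finset.range N, g (canonicalVector p n) * ψ (coord p n)) atTop
        (𝓝 (ψ g)) := fun ψ => by
    simpa [map_sum, Function.comp_def] using (ψ.continuous.tendsto g).comp (tendsto_sum_smul_coord g)
  refine tendsto_nhds_unique (hlim _) ?_
  simpa only [bidualEval_apply, hx] using hlim φ

theorem bidualEval_bijective : Function.Bijective (bidualEval (DPlus p)) := by
  refine ⟨fun x y h => toSeq_injective (funext fun n => ?_), exists_bidualEval_eq⟩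
  exact DFunLike.congr_fun h (coord p n)

/-- If `φ` is at most `ε` on the bounded set of functionals `powWeight r n • coord p n`, its
preimage has weighted sup-norm at most `ε`. -/
theorem tendsto_bidualEval_symm :
    Tendsto (Function.surjInv (bidualEval_bijective (p := p)).2) (𝓝 0) (𝓝 0) := by
  refine tendsto_of_bound fun r ε hε => ?_
  have := ContinuousLinearMap.eventually_nhds_zero_mapsTo (σ := RingHom.id ℂ) (F := ℂ)
    (isVonNBounded_range_powWeight_smul_coord r) (Metric.closedBall_mem_nhds (0 : ℂ) hε)
  filter_upwards [this] with φ hφ n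
  obtain ⟨x, rfl⟩ := exists_bidualEval_eq φ
  rw [Function.leftInverse_surjInv bidualEval_bijective x]
  have h1 := hφ ⟨n, rfl⟩
  simpa [abs_of_pos (powWeight_pos r n), mul_comm] using h1

theorem isReflexiveLCS : IsReflexiveLCS (DPlus p) := by
  let e := LinearEquiv.ofBijective (bidualEval (DPlus p)).toLinearMap bidualEval_bijective
  have he : ⇑e.symm = Function.surjInv (bidualEval_bijective (p := p)).2 := by
    funext φ
    rw [LinearEquiv.symm_apply_eq]
    exact (Function.surjInv_eq bidualEval_bijective.2 φ).symm
  refine ⟨⟨e, (bidualEval (DPlus p)).continuous, ?_⟩, fun _ _ => rfl⟩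
  refine continuous_of_continuousAt_zero e.symm ?_
  rw [ContinuousAt, map_zero, he]
  exact tendsto_bidualEval_symm

end DPlus

theorem lemma4p1 (p : ℝ) [Fact (1 ≤ p)] :
    IsFrechetSpace (DPlus p) ∧
    (∀ r : ℕ → Set.Ioi p, StrictAnti r → Tendsto (fun k => (r k : ℝ)) atTop (𝓝 p) →
      WithSeminorms (fun k => DPlus.seminorm p (r k))) ∧
    IsUnconditionalBasis (DPlus.canonicalVector p) ∧
    IsReflexiveLCS (DPlus p) ∧
    TopologicalSpace.SeparableSpace (DPlus p) ∧
    (∀ q : ℝ, p < q → dPlus p < dPlus q) :=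
  ⟨DPlus.isFrechetSpace, fun _ _ hr => DPlus.withSeminorms_of_tendsto hr,
    DPlus.isUnconditionalBasis_canonicalVector, DPlus.isReflexiveLCS, inferInstance,
    fun _ hq => dPlus_lt_dPlus Fact.out hq⟩
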